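/- Let $(R,\mathfrak m)$ be a complete regular local ring (of any characteristic), let $R^+$ be its absolute integral closure (the integral closure of the domain $R$ in an algebraic closure of its fraction field), and let $f\in R$. Let $B$ be a big Cohen--Macaulay $R^+$-algebra, that is, an $R^+$-algebra such that some system of parameters of $R$ is a regular sequence on $B$ (in particular $\mathfrak m B\neq B$). For real $t\ge 0$ put $$(fR^+)^{>t}=\Bigl\{g\in R^+ \;\Big|\; g^n\in f^mR^+ \text{ for some integers } m\ge 0,\ n>0 \text{ with } \tfrac mn>t\Bigr\}.$$ For an ideal $J\subseteq R$ put $$c_B^J(f)=\inf\{t\in\mathbb R_{\ge 0}\mid (fR^+)^{>t}\subseteq JB\}\in[0,\infty]$$ (so $c_B^J(f)=\infty$ if there is no such $t$), and let $\tau_B(f^t)\subseteq R$ be the ideal generated by all $\varphi(x)$ with $x\in (fR^+)^{>t}B$ and $\varphi\in\operatorname{Hom}_R(B,R)$. (a) For every ideal $J$ of $R$ with $c_B^J(f)<\infty$, $$\tau_B\bigl(f^{\,c_B^J(f)}\bigr)\subseteq J.$$ (b) Suppose that every extended ideal is closed in the $\mathfrak m$-adic topology of $B$, i.e. $\bigcap_{n}(J+\mathfrak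 m^n)B=JB$ for every ideal $J$ of $R$. Then for every real $\alpha\ge 0$, $$c_B^{\,\tau_B(f^\alpha)}(f)\le\alpha .$$ -/

import Mathlib

open IsLocalRing
open scoped NNReal ENNReal

universe u v

namespace BCM

/-! ### Regular local rings are domains -/

/-- An element of `m` outside `m ^ 2` can be exchanged into a generating set of `m`. -/
lemma maximalIdeal_exchange {R : Type*} [CommRing R] [IsLocalRing R] [DecidableEq R]
    (S : Finset R) (hS : Ideal.span (S : Set R) = maximalIdeal R) {x : R}
    (hx : x ∈ maximalIdeal R) (hx2 : x ∉ maximalIdeal R ^ 2) :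
    ∃ y ∈ S, maximalIdeal R = Ideal.span {x} ⊔ Ideal.span ((S.erase y : Finset R) : Set R) := by
  have hx' : x ∈ Ideal.span (S : Set R) := by rw [hS]; exact hx
  obtain ⟨a, -, ha⟩ := Submodule.mem_span_finset.1 hx'
  have hSm : ∀ y ∈ S, y ∈ maximalIdeal R := fun y hy => hS ▸ Ideal.subset_span hy
  have : ∃ y ∈ S, a y ∉ maximalIdeal R := by
    by_contra! h
    refine hx2 ?_
    rw [← ha, pow_two]
    exact Ideal.sum_mem _ fun y hy => Ideal.mul_mem_mul (h y hy) (hSm y hy)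
  obtain ⟨y, hy, hay⟩ := this
  refine ⟨y, hy, le_antisymm ?_ ?_⟩
  · rw [← hS, Ideal.span_le]
    intro z hz
    by_cases hzy : z = y
    · subst hzy
      have hu : IsUnit (a z) := by simpa using hay
      have e : a z * z = x - ∑ w ∈ S.erase z, a w * w := by
        rw [← ha, ← Finset.add_sum_erase S _ hy]; simp
      have : a z * z ∈ Ideal.span {x} ⊔ Ideal.span ((S.erase z : Finset R) : Set R) := by
        rw [e]
        refine Ideal.sub_mem _ (Ideal.mem_sup_left (Ideal.mem_span_singleton_self x))
          (Ideal.mem_sup_right (Ideal.sum_mem _ fun w hw => Ideal.mul_mem_left _ _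
            (Ideal.subset_span hw)))
      exact (Ideal.unit_mul_mem_iff_mem _ hu).1 this
    · exact Ideal.mem_sup_right (Ideal.subset_span (by simpa [hzy] using hz))
  · refine sup_le ((Ideal.span_singleton_le_iff_mem _).2 hx) (Ideal.span_le.2 fun z hz => ?_)
    exact hSm z (Finset.mem_of_mem_erase hz)

theorem isDomain_aux (n : ℕ) : ∀ (R : Type u) [CommRing R] [IsLocalRing R] [IsNoetherianRing R]
    (S : Finset R), Ideal.span (S : Set R) = maximalIdeal R → S.card ≤ n →
    (n : WithBot ℕ∞) ≤ ringKrullDim R → IsDomain R := by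
  classical
  induction n with
  | zero =>
    intro R _ _ _ S hS hc _
    have h0 : maximalIdeal R = ⊥ := by
      rw [← hS, Finset.card_eq_zero.1 (Nat.le_zero.1 hc)]; simp
    exact (isField_iff_maximalIdeal_eq.2 h0).isDomain
  | succ n ih =>
    intro R _ _ _ S hS hc hd
    have hdim : ¬ (ringKrullDim R ≤ 0) := fun h => by
      have := hd.trans h
      norm_cast at this
    have key : ∃ x ∈ maximalIdeal R, x ∉ maximalIdeal R ^ 2 ∧
        ∀ p ∈ minimalPrimes R, x ∉ p := by
      by_contra! h
      have hsub : ((maximalIdeal R : Ideal R) : Set R) ⊆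
          ⋃ i ∈ insert (maximalIdeal R ^ 2) (minimalPrimes R), ((i : Ideal R) : Set R) := by
        intro x hx
        by_cases hx2 : x ∈ maximalIdeal R ^ 2
        · exact Set.mem_biUnion (Set.mem_insert _ _) hx2
        · obtain ⟨p, hp, hxp⟩ := h x hx hx2
          exact Set.mem_biUnion (Set.mem_insert_of_mem _ hp) hxp
      obtain ⟨i, hi, hle⟩ := (Ideal.subset_union_prime_finite
        ((minimalPrimes.finite_of_isNoetherianRing R).insert _)
        (f := fun i : Ideal R => i) (maximalIdeal R ^ 2) (maximalIdeal R ^ 2)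
        (fun i hi h1 _ => by
          rcases hi with rfl | hi
          · exact absurd rfl h1
          · exact hi.1.1)).1 hsub
      rcases hi with rfl | hi
      · have hb : maximalIdeal R = ⊥ := by
          refine Submodule.eq_bot_of_le_smul_of_le_jacobson_bot (maximalIdeal R) (maximalIdeal R)
            (IsNoetherian.noetherian _) ?_ (maximalIdeal_le_jacobson _)
          rw [smul_eq_mul, ← pow_two]; exact hle
        have := (isField_iff_maximalIdeal_eq.2 hb)
        exact hdim (le_of_eq (ringKrullDim_eq_zero_of_isField this))
      · have hmin : maximalIdeal R ∈ minimalPrimes R := by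
          have := hi.1.1
          rwa [(maximalIdeal.isMaximal R).eq_of_le hi.1.1.ne_top hle]
        apply hdim
        rw [← maximalIdeal_height_eq_ringKrullDim, Ideal.height_eq_zero_iff.2 hmin]
        rfl
    obtain ⟨x, hx, hx2, hxp⟩ := key
    obtain ⟨y, hy, hmax⟩ := maximalIdeal_exchange S hS hx hx2
    have hne : Ideal.span {x} ≠ ⊤ := fun h => by
      have := (Ideal.span_singleton_le_iff_mem _).2 hx
      rw [h] at this
      exact (maximalIdeal.isMaximal R).ne_top (top_le_iff.1 this)
    have : Nontrivial (R ⧸ Ideal.span {x}) := Ideal.Quotient.nontrivial_iff.2 hne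
    have : IsLocalRing (R ⧸ Ideal.span {x}) :=
      IsLocalRing.of_surjective' (Ideal.Quotient.mk _) Ideal.Quotient.mk_surjective
    have hmap : (maximalIdeal R).map (Ideal.Quotient.mk (Ideal.span {x})) =
        maximalIdeal (R ⧸ Ideal.span {x}) :=
      map_maximalIdeal_of_surjective _ Ideal.Quotient.mk_surjective
    have hdq : (n : WithBot ℕ∞) ≤ ringKrullDim (R ⧸ Ideal.span {x}) := by
      have h1 : ringKrullDim R ≤ ringKrullDim (R ⧸ Ideal.span {x}) + 1 := by
        rw [← maximalIdeal_height_eq_ringKrullDim]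
        exact Ideal.height_le_ringKrullDim_quotient_add_one hx
      have h2 := hd.trans h1
      push_cast at h2
      exact (ENat.WithBot.add_le_add_one_right_iff).1 h2
    set T := (S.erase y).image (Ideal.Quotient.mk (Ideal.span {x})) with hT
    have hTs : Ideal.span (T : Set (R ⧸ Ideal.span {x})) = maximalIdeal _ := by
      rw [← hmap, hmax, Ideal.map_sup, Ideal.map_span, Ideal.map_span, hT]
      simp
    have hTc : T.card ≤ n := Finset.card_image_le.trans (by rw [Finset.card_erase_of_mem hy]; omega)
    have := ih _ T hTs hTc hdq
    have hprime : (Ideal.span {x}).IsPrime := (Ideal.Quotient.isDomain_iff_prime _).1 this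
    obtain ⟨q, hq, hqx⟩ := Ideal.exists_minimalPrimes_le (bot_le : ⊥ ≤ Ideal.span {x})
    have hq0 : q = ⊥ := by
      refine Submodule.eq_bot_of_le_smul_of_le_jacobson_bot (maximalIdeal R) q
        (IsNoetherian.noetherian _) ?_ (maximalIdeal_le_jacobson _)
      intro z hz
      obtain ⟨r, rfl⟩ := Ideal.mem_span_singleton'.1 (hqx hz)
      have hr : r ∈ q := (hq.1.1.mem_or_mem hz).resolve_right (hxp q hq)
      rw [mul_comm]
      exact Ideal.mul_mem_mul hx hr
    have := hq.1.1
    rw [hq0] at this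
    exact IsDomain.of_bot_isPrime R

/-- A regular local ring is a domain, so that its absolute integral closure makes sense. -/
instance isDomain_of_isRegularLocalRing (R : Type u) [CommRing R] [IsRegularLocalRing R] :
    IsDomain R := by
  obtain ⟨S, hc, hS⟩ :=
    (IsNoetherian.noetherian (maximalIdeal R)).exists_span_finset_card_eq_spanFinrank
  refine isDomain_aux _ R S hS hc.le ?_
  rw [← IsRegularLocalRing.spanFinrank_maximalIdeal]

/-! ### The absolute integral closure -/

/-- `R⁺`: the integral closure of the domain `R` in an algebraic closure of its fraction field. -/
abbrev AbsIntClosure (R : Type u) [CommRing R] [IsDomain R] : Type u :=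
  integralClosure R (AlgebraicClosure (FractionRing R))

/-! ### Big Cohen-Macaulay algebras -/

/-- `rs` is a system of parameters of the (Noetherian) local ring `R`: a sequence of `dim R`
elements generating an ideal primary to the maximal ideal. -/
def IsSystemOfParameters (R : Type u) [CommRing R] [IsLocalRing R] (rs : List R) : Prop :=
  (rs.length : WithBot ℕ∞) = ringKrullDim R ∧ (Ideal.ofList rs).radical = maximalIdeal R

/-- The `R`-algebra `B` is a big Cohen-Macaulay algebra: some system of parameters of `R` is a
regular sequence on `B` (which includes `B ≠ (rs) B`). In particular this covers the balanced
ones, for which every system of parameters is a regular sequence. -/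
def IsBigCohenMacaulay (R : Type u) [CommRing R] [IsLocalRing R]
    (B : Type v) [CommRing B] [Algebra R B] : Prop :=
  ∃ rs : List R, IsSystemOfParameters R rs ∧ RingTheory.Sequence.IsRegular B rs

/-- Each extended ideal `J B` (with `J` an ideal of `R`) is closed in the `m`-adic topology of
`B`, i.e. `⋂ₙ (J + mⁿ) B = J B`; equivalently each `B / J B` is `m`-adically separated. -/
def ExtendedIdealsClosed (R : Type u) [CommRing R] [IsLocalRing R]
    (B : Type v) [CommRing B] [Algebra R B] : Prop :=
  ∀ J : Ideal R,
    ⨅ n : ℕ, (J ⊔ maximalIdeal R ^ n).map (algebraMap R B) = J.map (algebraMap R B)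

/-! ### Thresholds and test ideals -/

/-- `(f S)^{> t} = {g ∈ S | g ^ n ∈ f ^ m S for some m / n > t}`. -/
def rootPower {R : Type u} [CommRing R] (S : Type v) [CommRing S] [Algebra R S]
    (f : R) (t : ℝ≥0) : Set S :=
  {g | ∃ m n : ℕ, 0 < n ∧ t < (m : ℝ≥0) / n ∧ g ^ n ∈ Ideal.span {algebraMap R S f ^ m}}

section

variable {R : Type u} [CommRing R] [IsDomain R]
  (B : Type v) [CommRing B] [Algebra R B] [Algebra (AbsIntClosure R) B]

/-- The condition `(f R⁺)^{> t} ⊆ J B`. -/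
def RootPowerSubset (J : Ideal R) (f : R) (t : ℝ≥0) : Prop :=
  algebraMap (AbsIntClosure R) B '' rootPower (AbsIntClosure R) f t ⊆ J.map (algebraMap R B)

/-- The threshold `c_B^J(f) = inf {t ≥ 0 | (f R⁺)^{> t} ⊆ J B}`, an element of `[0, ∞]`
(it is `∞` if there is no such `t`). -/
noncomputable def threshold (J : Ideal R) (f : R) : ℝ≥0∞ :=
  ⨅ (t : ℝ≥0) (_ : RootPowerSubset B J f t), (t : ℝ≥0∞)

/-- The threshold is also `sup {t ≥ 0 | (f R⁺)^{> t} ⊄ J B}`. -/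
theorem threshold_eq_iSup (J : Ideal R) (f : R) :
    threshold B J f = ⨆ (t : ℝ≥0) (_ : ¬ RootPowerSubset B J f t), (t : ℝ≥0∞) := by
  have mono : ∀ s t : ℝ≥0, s ≤ t → RootPowerSubset B J f s → RootPowerSubset B J f t := by
    rintro s t hst hs _ ⟨g, ⟨m, n, hn, hlt, hg⟩, rfl⟩
    exact hs ⟨g, ⟨m, n, hn, hst.trans_lt hlt, hg⟩, rfl⟩
  apply le_antisymm
  · refine ENNReal.le_of_forall_nnreal_lt fun r hr => ?_
    refine le_iSup₂_of_le r (fun h => ?_) le_rfl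
    exact absurd hr (not_lt.2 (iInf₂_le r h))
  · refine iSup₂_le fun s hs => le_iInf₂ fun t ht => ?_
    rw [ENNReal.coe_le_coe]
    by_contra! h
    exact hs (mono t s h.le ht)

/-- The test ideal `τ_B(f ^ t)`: the ideal of `R` generated by all `φ x` with
`x ∈ (f R⁺)^{> t} B` and `φ ∈ Hom_R(B, R)`. -/
def testIdeal (f : R) (t : ℝ≥0) : Ideal R :=
  Ideal.span {r | ∃ x ∈ Ideal.span (algebraMap (AbsIntClosure R) B ''
    rootPower (AbsIntClosure R) f t), ∃ φ : B →ₗ[R] R, φ x = r}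

end

end BCM

/-! Part (a) is formal: an `R`-linear form sends `J B` into `J`, and the strict inequality `m / n >
c` leaves room for an admissible `t` between, so it is irrelevant whether the infimum is attained.
Part (b) rests on the fact that `B` looks free modulo every power of the maximal ideal `𝔪`. Lift a
basis of `B / 𝔪 B` to a map `Φ` from a free module to `B`. Since `R` is regular, `𝔪` has as many
generators `y` as a system of parameters has elements, so a regular sequence of that length kills
the Koszul homology of `y` on `B` in positive degrees (`exists_curryLeft_eq_of_isWeaklyRegular`).
Vanishing of `H₁` makes `Φ` an isomorphism modulo each `𝔪ⁿ` (`mem_pow_smul_top_of_apply_mem`). As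
`R` is complete, the coordinates glue to linear forms on `B` (`exists_coordinate_functional`). If
all linear forms send `b` into `J`, its coordinates lie in `J + 𝔪ⁿ`, hence `b ∈ (J + 𝔪ⁿ) B` for all
`n`, and closedness gives `b ∈ J B`. -/

namespace BCM

/-! ### Koszul homology, with chains the alternating forms on `R ^ d` and differential the
contraction `curryLeft y`. -/

/-- Alternating forms on a free module lift along a linear map whose range contains their values. -/
lemma exists_compAlternatingMap_eq {R E M N : Type*} [CommRing R] [AddCommGroup E] [Module R E]
    [Module.Free R E] [AddCommGroup M] [Module R M] [AddCommGroup N] [Module R N] {n : ℕ}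
    (p : M →ₗ[R] N) (z : E [⋀^Fin n]→ₗ[R] N) (hz : ∀ v, z v ∈ LinearMap.range p) :
    ∃ w : E [⋀^Fin n]→ₗ[R] M, p.compAlternatingMap w = z := by
  -- Exterior powers of a free module are free, hence projective.
  obtain ⟨h, hh⟩ := Module.projective_lifting_property p.rangeRestrict
    (exteriorPower.alternatingMapLinearEquiv (z.codRestrict (LinearMap.range p) hz))
    p.surjective_rangeRestrict
  refine ⟨h.compAlternatingMap (exteriorPower.ιMulti R n), ?_⟩
  ext v
  have := congrArg Subtype.val (LinearMap.congr_fun hh (exteriorPower.ιMulti R n v))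
  rw [exteriorPower.alternatingMapLinearEquiv_apply_ιMulti] at this
  exact this

/-- The Koszul homotopy: wedging with a linear form `α` inverts contraction by `y` on cycles,
up to the scalar `α y`. -/
lemma curryLeft_alternatizeUncurryFin_smulRight {R E M : Type*} [CommRing R] [AddCommGroup E]
    [Module R E] [AddCommGroup M] [Module R M] {n : ℕ} (α : E →ₗ[R] R) (y : E)
    (z : E [⋀^Fin (n + 1)]→ₗ[R] M) (hz : z.curryLeft y = 0) :
    (AlternatingMap.alternatizeUncurryFin (α.smulRight z)).curryLeft y = α y • z := by
  ext v
  rw [AlternatingMap.curryLeft_apply_apply, AlternatingMap.alternatizeUncurryFin_apply,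
    Fin.sum_univ_succ, Finset.sum_eq_zero, add_zero]
  · simp [Matrix.vecCons]
  -- In the later terms `y` stays the first argument of `z`, so the cycle condition kills them.
  · intro i _
    have h : Fin.removeNth i.succ (Matrix.vecCons y v) = Matrix.vecCons y (Fin.removeNth i v) := by
      funext j
      refine Fin.cases ?_ (fun j => ?_) j <;> simp [Fin.removeNth, Matrix.vecCons]
    have h' : z (Matrix.vecCons y (Fin.removeNth i v)) = 0 := by
      rw [← AlternatingMap.curryLeft_apply_apply, hz, AlternatingMap.zero_apply]
    simp [h, h']

/-- Alternating forms on `R ^ d` of degree exceeding `d` vanish. -/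
lemma alternatingMap_eq_zero_of_lt {R M : Type*} [CommRing R] [AddCommGroup M] [Module R M]
    {d n : ℕ} (h : d < n) (z : (Fin d → R) [⋀^Fin n]→ₗ[R] M) : z = 0 := by
  refine (Pi.basisFun R (Fin d)).ext_alternating fun v hv => ?_
  have := Fintype.card_le_of_injective v hv
  simp only [Fintype.card_fin] at this
  omega

/-- Koszul acyclicity: if a weakly regular sequence of length `k` on `M` lies in the ideal
generated by the `d` coordinates of `y`, then the Koszul homology of `y` with coefficients in `M`
vanishes in positive degrees exceeding `d - k`. -/
theorem exists_curryLeft_eq_of_isWeaklyRegular {R : Type u} [CommRing R] {d : ℕ} (y : Fin d → R)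
    (rs : List R) : ∀ (M : Type v) [AddCommGroup M] [Module R M],
    (∀ r ∈ rs, r ∈ Ideal.span (Set.range y)) → RingTheory.Sequence.IsWeaklyRegular M rs →
    ∀ (n : ℕ), d < n + 1 + rs.length → ∀ z : (Fin d → R) [⋀^Fin (n + 1)]→ₗ[R] M,
    z.curryLeft y = 0 → ∃ w : (Fin d → R) [⋀^Fin (n + 2)]→ₗ[R] M, w.curryLeft y = z := by
  induction rs with
  | nil =>
    intro M _ _ _ _ n hn z _
    exact ⟨0, by rw [alternatingMap_eq_zero_of_lt (by simpa using hn) z]; rfl⟩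
  | cons x rs ih =>
    intro M _ _ hrs hreg n hn z hz
    rw [RingTheory.Sequence.isWeaklyRegular_cons_iff] at hreg
    obtain ⟨c, hc⟩ := Ideal.mem_span_range_iff_exists_fun.1 (hrs x List.mem_cons_self)
    let α : (Fin d → R) →ₗ[R] R := Fintype.linearCombination R c
    have hα : α y = x := by
      simp only [α, Fintype.linearCombination_apply, smul_eq_mul, ← hc, mul_comm]
    let w := AlternatingMap.alternatizeUncurryFin (α.smulRight z)
    have hw : w.curryLeft y = x • z := by
      rw [← hα]; exact curryLeft_alternatizeUncurryFin_smulRight α y z hz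
    let q : M →ₗ[R] QuotSMulTop x M := Submodule.mkQ _
    have hq : ∀ m, q (x • m) = 0 := fun m =>
      (Submodule.Quotient.mk_eq_zero _).2 (Submodule.smul_mem_pointwise_smul _ _ _ trivial)
    -- `w` has boundary `x • z`, so it is a cycle modulo `x`. The sequence is one shorter and the
    -- degree one higher, so the bound on `d` persists.
    obtain ⟨vb, hvb⟩ := ih (QuotSMulTop x M) (fun r hr => hrs r (List.mem_cons_of_mem _ hr))
      hreg.2 (n + 1) (by simp only [List.length_cons] at hn; omega) (q.compAlternatingMap w) (by
        rw [AlternatingMap.curryLeft_compAlternatingMap, hw]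
        ext a
        exact hq _)
    obtain ⟨v, rfl⟩ := exists_compAlternatingMap_eq q vb
      (fun _ => by rw [LinearMap.range_eq_top.2 (Submodule.mkQ_surjective _)]; trivial)
    -- With `∂` the contraction, `x • t = w - ∂v` gives `x • ∂t = ∂w = x • z`, and `x` cancels.
    obtain ⟨t, ht⟩ := exists_compAlternatingMap_eq (LinearMap.lsmul R M x) (w - v.curryLeft y)
      (fun a => by
        have h1 : q ((w - v.curryLeft y) a) = 0 := by
          have := congrArg (fun g => g a) hvb
          rw [AlternatingMap.curryLeft_compAlternatingMap] at this
          rw [AlternatingMap.sub_apply, map_sub, sub_eq_zero]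
          exact this.symm
        obtain ⟨m, -, hm⟩ := (Submodule.mem_smul_pointwise_iff_exists _ _ _).1
          ((Submodule.Quotient.mk_eq_zero _).1 h1)
        exact ⟨m, hm⟩)
    refine ⟨t, ?_⟩
    ext a
    apply hreg.1
    have h1 := congrArg (fun g => g (Matrix.vecCons y a)) ht
    have h2 := congrArg (fun g => g a) hw
    have h3 : v.curryLeft y (Matrix.vecCons y a) = 0 := by
      rw [← AlternatingMap.curryLeft_apply_apply, AlternatingMap.curryLeft_same]; rfl
    simp only [LinearMap.compAlternatingMap_apply, LinearMap.lsmul_apply,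
      AlternatingMap.sub_apply, h3, sub_zero] at h1
    simp only [AlternatingMap.curryLeft_apply_apply, AlternatingMap.smul_apply] at h2 ⊢
    rw [h1, h2]

/-! ### Maps from free modules that are isomorphisms modulo powers of an ideal. -/

section

variable {R : Type u} [CommRing R] {d : ℕ} {y : Fin d → R}

/-- Elements of `(y) N` are the values at `y` of linear maps `R ^ d → N`. -/
lemma exists_apply_eq_of_mem_span_smul {M : Type*} [AddCommGroup M] [Module R M]
    {N : Submodule R M} {b : M} (hb : b ∈ Ideal.span (Set.range y) • N) :
    ∃ c : (Fin d → R) →ₗ[R] M, (∀ a, c a ∈ N) ∧ c y = b := by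
  induction hb using Submodule.smul_induction_on' with
  | smul r hr m hm =>
    obtain ⟨c, hc⟩ := Ideal.mem_span_range_iff_exists_fun.1 hr
    refine ⟨(Fintype.linearCombination R c).smulRight m, fun a => N.smul_mem _ hm, ?_⟩
    simp only [LinearMap.smulRight_apply, Fintype.linearCombination_apply, smul_eq_mul, ← hc,
      mul_comm]
  | add _ _ _ _ h₁ h₂ =>
    obtain ⟨c₁, h₁, rfl⟩ := h₁
    obtain ⟨c₂, h₂, rfl⟩ := h₂
    exact ⟨c₁ + c₂, fun a => N.add_mem (h₁ a) (h₂ a), rfl⟩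

lemma apply_mem_span_smul {M : Type*} [AddCommGroup M] [Module R M]
    {N : Submodule R M} (c : (Fin d → R) →ₗ[R] M) (hc : ∀ a, c a ∈ N) :
    c y ∈ Ideal.span (Set.range y) • N := by
  rw [LinearMap.pi_apply_eq_sum_univ c y]
  exact Submodule.sum_mem _ fun i _ =>
    Submodule.smul_mem_smul (Ideal.subset_span ⟨i, rfl⟩) (hc _)

end

lemma range_sup_pow_smul_top {R F M : Type*} [CommRing R] {I : Ideal R} [AddCommGroup F]
    [Module R F] [AddCommGroup M] [Module R M] (Φ : F →ₗ[R] M)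
    (h : LinearMap.range Φ ⊔ I • ⊤ = ⊤) (n : ℕ) :
    LinearMap.range Φ ⊔ (I ^ n • ⊤ : Submodule R M) = ⊤ := by
  induction n with
  | zero => simp
  | succ n ih =>
    refine top_le_iff.1 (h.symm.le.trans (sup_le le_sup_left ?_))
    conv_lhs => rw [← ih]
    rw [Submodule.smul_sup, pow_succ', Submodule.mul_smul]
    exact sup_le_sup_right Submodule.smul_le_right _

/-- If `Φ : F → M` is an isomorphism modulo `I = (y)` and the first Koszul homology of `y` on `M`
vanishes, then `Φ` is an isomorphism modulo every power of `I`. -/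
theorem mem_pow_smul_top_of_apply_mem {R : Type u} [CommRing R] {d : ℕ} (y : Fin d → R)
    {F M : Type*} [AddCommGroup F] [Module R F] [AddCommGroup M] [Module R M]
    (hK : ∀ z : (Fin d → R) [⋀^Fin 1]→ₗ[R] M, z.curryLeft y = 0 →
      ∃ w : (Fin d → R) [⋀^Fin 2]→ₗ[R] M, w.curryLeft y = z)
    (Φ : F →ₗ[R] M) (hs : LinearMap.range Φ ⊔ Ideal.span (Set.range y) • ⊤ = ⊤)
    (hi : ∀ r, Φ r ∈ Ideal.span (Set.range y) • (⊤ : Submodule R M) →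
      r ∈ Ideal.span (Set.range y) • (⊤ : Submodule R F)) (n : ℕ) :
    ∀ r, Φ r ∈ Ideal.span (Set.range y) ^ n • (⊤ : Submodule R M) →
      r ∈ Ideal.span (Set.range y) ^ n • (⊤ : Submodule R F) := by
  set I := Ideal.span (Set.range y) with hI
  induction n with
  | zero => simp
  | succ n ih =>
    intro r hr
    obtain ⟨s, -, hs'⟩ := exists_apply_eq_of_mem_span_smul
      (hi r (Submodule.smul_mono_left (Ideal.pow_le_self n.succ_ne_zero) hr))
    rw [pow_succ', Submodule.mul_smul] at hr ⊢
    obtain ⟨c, hcN, hc⟩ := exists_apply_eq_of_mem_span_smul hr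
    -- Both `Φ ∘ s` and `c` take the value `Φ r` at `y`, so their difference is a 1-cycle.
    obtain ⟨w, hw⟩ := hK (AlternatingMap.ofSubsingleton R _ _ (0 : Fin 1) (Φ ∘ₗ s - c)) (by
      ext a
      simp [Matrix.vecCons, hs', hc])
    let q : M →ₗ[R] M ⧸ (I ^ n • ⊤ : Submodule R M) := Submodule.mkQ _
    have hq : LinearMap.range (q ∘ₗ Φ) = ⊤ := by
      have h := congrArg (Submodule.map q) (range_sup_pow_smul_top Φ hs n)
      rw [Submodule.map_sup, Submodule.mkQ_map_self, sup_bot_eq, Submodule.map_top,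
        Submodule.range_mkQ] at h
      rw [LinearMap.range_comp, h]
    obtain ⟨v, hv⟩ := exists_compAlternatingMap_eq (q ∘ₗ Φ) (q.compAlternatingMap w)
      (fun _ => by rw [hq]; trivial)
    have hv' : ∀ a, Φ (v a) - w a ∈ (I ^ n • ⊤ : Submodule R M) := fun a =>
      (Submodule.Quotient.eq _).1 (congrArg (fun g => g a) hv)
    -- Subtracting a boundary keeps the value `r` at `y`, but now `Φ ∘ s'` has values in `I ^ n •
    -- ⊤`, so induction applies to each `s' a`.
    let s' := s - (AlternatingMap.ofSubsingleton R _ _ (0 : Fin 1)).symm (v.curryLeft y)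
    have hsv : ∀ a, s' a = s a - v ![y, a] := fun a => by
      refine congrArg (s a - ·) ?_
      change v (Matrix.vecCons y _) = _
      exact congrArg v (by ext i : 1; fin_cases i <;> rfl)
    have hs'y : s' y = r := by
      rw [hsv, v.map_eq_zero_of_eq _ (i := 0) (j := 1) rfl (by decide), sub_zero, hs']
    rw [← hs'y]
    refine apply_mem_span_smul s' fun a => ih _ ?_
    have h1 : w ![y, a] = Φ (s a) - c a := by
      have := congrArg (fun g => g ![a]) hw
      simpa using this
    have : Φ (s' a) = c a - (Φ (v ![y, a]) - w ![y, a]) := by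
      rw [hsv, h1, map_sub]; abel
    rw [this]
    exact Submodule.sub_mem _ (hcN a) (hv' _)

/-- Over an `I`-adically complete ring, the coordinates of a map from a free module that is an
isomorphism modulo all powers of `I` extend to linear forms on the target. -/
theorem exists_coordinate_functional {R : Type u} [CommRing R] {I : Ideal R} [IsAdicComplete I R]
    {ι M : Type*} [AddCommGroup M] [Module R M] (Φ : (ι →₀ R) →ₗ[R] M)
    (hs : LinearMap.range Φ ⊔ I • ⊤ = ⊤)
    (hi : ∀ n r, Φ r ∈ I ^ n • (⊤ : Submodule R M) → r ∈ I ^ n • (⊤ : Submodule R (ι →₀ R)))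
    (i : ι) : ∃ φ : M →ₗ[R] R, ∀ n b r, b - Φ r ∈ I ^ n • (⊤ : Submodule R M) →
      φ b - r i ∈ I ^ n := by
  have hex : ∀ n b, ∃ r, b - Φ r ∈ (I ^ n • ⊤ : Submodule R M) := fun n b => by
    have : b ∈ LinearMap.range Φ ⊔ (I ^ n • ⊤ : Submodule R M) := by
      rw [range_sup_pow_smul_top Φ hs n]; trivial
    obtain ⟨_, ⟨r, rfl⟩, t, ht, rfl⟩ := Submodule.mem_sup.1 this
    exact ⟨r, by simpa using ht⟩
  have hco : ∀ n r, r ∈ I ^ n • (⊤ : Submodule R (ι →₀ R)) → r i ∈ (I ^ n • ⊤ : Submodule R R) :=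
    fun n r hr => Submodule.smul_top_le_comap_smul_top _ (Finsupp.lapply i) hr
  choose ρ hρ using hex
  have huniq : ∀ n b r, b - Φ r ∈ (I ^ n • ⊤ : Submodule R M) →
      (Submodule.Quotient.mk (ρ n b i) : R ⧸ (I ^ n • ⊤ : Submodule R R)) =
        Submodule.Quotient.mk (r i) := fun n b r hr => by
    rw [Submodule.Quotient.eq]
    refine hco n (ρ n b - r) (hi n _ ?_)
    have : Φ (ρ n b - r) = (b - Φ r) - (b - Φ (ρ n b)) := by rw [map_sub]; abel
    rw [this]
    exact Submodule.sub_mem _ hr (hρ n b)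
  -- The `i`-th coordinate of any approximation of `b` modulo `I ^ n`; independence of the choice
  -- (`huniq`) yields linearity and compatibility in `n`.
  let g : ∀ n, M →ₗ[R] R ⧸ (I ^ n • ⊤ : Submodule R R) := fun n =>
    { toFun := fun b => Submodule.Quotient.mk (ρ n b i)
      map_add' := fun b c => by
        rw [huniq n (b + c) (ρ n b + ρ n c), Finsupp.add_apply, Submodule.Quotient.mk_add]
        have : b + c - Φ (ρ n b + ρ n c) = (b - Φ (ρ n b)) + (c - Φ (ρ n c)) := by
          rw [map_add]; abel
        rw [this]
        exact Submodule.add_mem _ (hρ n b) (hρ n c)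
      map_smul' := fun a b => by
        rw [huniq n (a • b) (a • ρ n b), Finsupp.smul_apply, Submodule.Quotient.mk_smul]
        · rfl
        rw [map_smul, ← smul_sub]
        exact Submodule.smul_mem _ _ (hρ n b) }
  have hg : ∀ {m n : ℕ} (hle : m ≤ n), Submodule.factorPow I R hle ∘ₗ g n = g m := fun
      {m n} hle => by
    ext b
    exact (huniq m b (ρ n b) (Submodule.pow_smul_top_le I M hle (hρ n b))).symm
  refine ⟨IsAdicComplete.lift I g hg, fun n b r hr => ?_⟩
  have h := (Submodule.Quotient.eq _).1
    ((IsAdicComplete.mk_lift I hg n b).trans (huniq n b r hr))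
  simpa using h

/-- Over a local ring, every module receives a map from a free module that is an isomorphism
modulo the maximal ideal. -/
theorem exists_finsupp_map_bijective_mod {R : Type u} [CommRing R] [IsLocalRing R]
    (M : Type v) [AddCommGroup M] [Module R M] :
    ∃ (ι : Type v) (Φ : (ι →₀ R) →ₗ[R] M), LinearMap.range Φ ⊔ maximalIdeal R • ⊤ = ⊤ ∧
      ∀ r, Φ r ∈ maximalIdeal R • (⊤ : Submodule R M) →
        r ∈ maximalIdeal R • (⊤ : Submodule R (ι →₀ R)) := by
  let q : M →ₗ[R] M ⧸ (maximalIdeal R • ⊤ : Submodule R M) := Submodule.mkQ _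
  let := Ideal.Quotient.field (maximalIdeal R)
  let b := Module.Basis.ofVectorSpace (R ⧸ maximalIdeal R)
    (M ⧸ (maximalIdeal R • ⊤ : Submodule R M))
  choose e he using fun i => Submodule.mkQ_surjective _ (b i)
  have hq : ∀ r, q (Finsupp.linearCombination R e r) =
      Finsupp.linearCombination (R ⧸ maximalIdeal R) b
        (r.mapRange (Ideal.Quotient.mk (maximalIdeal R)) (map_zero _)) := fun r => by
    rw [Finsupp.linearCombination_apply, Finsupp.linearCombination_apply,
      Finsupp.sum_mapRange_index (by simp), map_finsuppSum]
    refine Finsupp.sum_congr fun i _ => ?_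
    rw [map_smul, he]
    rfl
  refine ⟨_, Finsupp.linearCombination R e, ?_, fun r hr => ?_⟩
  · refine top_le_iff.1 fun x _ => ?_
    obtain ⟨s, hs⟩ := Finsupp.mapRange_surjective (Ideal.Quotient.mk (maximalIdeal R))
      (map_zero _) Ideal.Quotient.mk_surjective (b.repr (q x))
    have h : q (x - Finsupp.linearCombination R e s) = 0 := by
      rw [map_sub, hq, hs, b.linearCombination_repr, sub_self]
    refine Submodule.mem_sup.2 ⟨_, ⟨s, rfl⟩, _, (Submodule.Quotient.mk_eq_zero _).1 h, ?_⟩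
    abel
  · have h0 := hq r
    have hr0 : q (Finsupp.linearCombination R e r) = 0 := (Submodule.Quotient.mk_eq_zero _).2 hr
    rw [hr0] at h0
    have h := (linearIndependent_iff.1 b.linearIndependent) _ h0.symm
    rw [← r.sum_single]
    refine Submodule.sum_mem _ fun i _ => ?_
    have hri : r i ∈ maximalIdeal R := Ideal.Quotient.eq_zero_iff_mem.1 (by
      simpa using DFunLike.congr_fun h i)
    have : Finsupp.single i (r i) = r i • Finsupp.single i (1 : R) := by simp
    rw [this]
    exact Submodule.smul_mem_smul hri trivial

/-! ### Big Cohen-Macaulay algebras and the two inequalities. -/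

/-- Over a complete regular local ring, an element of a big Cohen-Macaulay algebra lies,
modulo any power of the maximal ideal, in the extension of any ideal containing its images under
all linear forms. -/
theorem mem_map_sup_pow_of_forall_apply_mem {R : Type u} [CommRing R] [IsRegularLocalRing R]
    [IsAdicComplete (maximalIdeal R) R] {B : Type v} [CommRing B] [Algebra R B]
    (hB : IsBigCohenMacaulay R B) {J : Ideal R} {b : B} (hb : ∀ φ : B →ₗ[R] R, φ b ∈ J) (n : ℕ) :
    b ∈ (J ⊔ maximalIdeal R ^ n).map (algebraMap R B) := by
  obtain ⟨rs, ⟨hlen, hrad⟩, hreg⟩ := hB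
  obtain ⟨y, hy⟩ : ∃ y : Fin rs.length → R, Ideal.span (Set.range y) = maximalIdeal R := by
    obtain ⟨S, hc, hS⟩ :=
      (IsNoetherian.noetherian (maximalIdeal R)).exists_span_finset_card_eq_spanFinrank
    have hcard : S.card = rs.length := by
      have := IsRegularLocalRing.spanFinrank_maximalIdeal (R := R)
      rw [← hlen] at this
      rw [hc]
      exact_mod_cast this
    refine ⟨fun i => (S.equivFinOfCardEq hcard).symm i, ?_⟩
    rw [← hS]
    congr 1
    ext x
    constructor
    · rintro ⟨i, rfl⟩
      exact Subtype.coe_prop _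
    · exact fun hx => ⟨S.equivFinOfCardEq hcard ⟨x, hx⟩, by simp⟩
  obtain ⟨ι, Φ, hs, hi⟩ := exists_finsupp_map_bijective_mod (R := R) B
  -- Only `H₁` is needed; this is where the number of generators of `𝔪` must equal the length of
  -- `rs`.
  have hK := exists_curryLeft_eq_of_isWeaklyRegular y rs B
    (fun r hr => by
      rw [hy, ← hrad]
      exact Ideal.le_radical (Ideal.subset_span hr)) hreg.toIsWeaklyRegular 0 (by omega)
  have hi' : ∀ n r, Φ r ∈ maximalIdeal R ^ n • (⊤ : Submodule R B) →
      r ∈ maximalIdeal R ^ n • (⊤ : Submodule R (ι →₀ R)) := fun n => by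
    rw [← hy] at hs hi ⊢
    exact mem_pow_smul_top_of_apply_mem y hK Φ hs hi n
  have hmem : b ∈ LinearMap.range Φ ⊔ (maximalIdeal R ^ n • ⊤ : Submodule R B) := by
    rw [range_sup_pow_smul_top Φ hs n]; trivial
  obtain ⟨_, ⟨r, rfl⟩, t, ht, hrt⟩ := Submodule.mem_sup.1 hmem
  have hr : ∀ i, r i ∈ J ⊔ maximalIdeal R ^ n := fun i => by
    obtain ⟨φ, hφ⟩ := exists_coordinate_functional Φ hs hi' i
    have h := hφ n b r (by rw [← hrt, add_sub_cancel_left]; exact ht)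
    rw [← sub_sub_cancel (φ b) (r i)]
    exact Ideal.sub_mem _ (Ideal.mem_sup_left (hb φ)) (Ideal.mem_sup_right h)
  rw [← hrt]
  refine Ideal.add_mem _ ?_ ?_
  · rw [← r.sum_single, map_finsuppSum]
    refine Ideal.sum_mem _ fun i _ => ?_
    have : Finsupp.single i (r i) = r i • Finsupp.single i (1 : R) := by simp
    dsimp only
    rw [this, map_smul, Algebra.smul_def]
    exact Ideal.mul_mem_right _ _ (Ideal.mem_map_of_mem _ (hr i))
  · rw [Ideal.smul_top_eq_map] at ht
    exact Ideal.map_mono le_sup_right ht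

lemma apply_mem_of_mem_map {R B : Type*} [CommRing R] [CommRing B] [Algebra R B] {J : Ideal R}
    {x : B} (hx : x ∈ J.map (algebraMap R B)) (φ : B →ₗ[R] R) : φ x ∈ J := by
  have h : x ∈ (J • ⊤ : Submodule R B) := by rw [Ideal.smul_top_eq_map]; exact hx
  simpa using Submodule.smul_top_le_comap_smul_top J φ h

end BCM

theorem mainTheorem2 {R : Type u} [CommRing R] [IsRegularLocalRing R]
    [IsAdicComplete (IsLocalRing.maximalIdeal R) R] (f : R)
    {B : Type v} [CommRing B] [Algebra R B] [Algebra (BCM.AbsIntClosure R) B]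
    [IsScalarTower R (BCM.AbsIntClosure R) B] (hB : BCM.IsBigCohenMacaulay R B) :
    (∀ (J : Ideal R) (c : ℝ≥0), BCM.threshold B J f = c → BCM.testIdeal B f c ≤ J) ∧
    (BCM.ExtendedIdealsClosed R B →
      ∀ α : ℝ≥0, BCM.threshold B (BCM.testIdeal B f α) f ≤ α) := by
  constructor
  · intro J c hc
    refine Ideal.span_le.2 ?_
    rintro _ ⟨x, hx, φ, rfl⟩
    refine BCM.apply_mem_of_mem_map ((Ideal.span_le.2 ?_ : Ideal.span _ ≤ _) hx) φ
    rintro _ ⟨g, ⟨m, n, hn, hlt, hg⟩, rfl⟩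
    have h : BCM.threshold B J f < ((m / n : ℝ≥0) : ℝ≥0∞) := by
      rw [hc]; exact_mod_cast hlt
    obtain ⟨t, ht⟩ := iInf_lt_iff.1 h
    obtain ⟨ht', hlt'⟩ := iInf_lt_iff.1 ht
    exact ht' ⟨g, ⟨m, n, hn, by exact_mod_cast hlt', hg⟩, rfl⟩
  · intro hcl α
    refine iInf₂_le α ?_
    rintro x hx
    rw [← hcl, SetLike.mem_coe, Ideal.mem_iInf]
    exact BCM.mem_map_sup_pow_of_forall_apply_mem hB fun φ =>
      Ideal.subset_span ⟨x, Ideal.subset_span hx, φ, rfl⟩
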